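/- Let $V$ be a simple vertex algebra over $\mathbb{C}$ of countable dimension, where simple means that $V\neq 0$ and that $V$ has no ideals other than $0$ and $V$ (an ideal being a subspace $I$ with $v_n a\in I$ and $a_n v\in I$ for all $v\in V$, $a\in I$, $n\in\mathbb{Z}$). Let $G$ be a finite group of automorphisms of $V$, that is, a finite subgroup of $\mathrm{Aut}(V)$. Then every irreducible $G$-module over $\mathbb{C}$ appears in $V$: for every irreducible complex representation $W$ of $G$ there is a $G$-submodule of $V$ that is isomorphic to $W$. -/

import Mathlib

/-- A vertex algebra structure over `ℂ` on a vector space `V`. Here `Y v n` is the mode `v_n` in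
`Y(v, z) = ∑ v_n z^(-n-1)`, so that `Y` is the linear map `V → (End V)[[z, z⁻¹]]`. -/
class VertexAlgebra (V : Type*) [AddCommGroup V] [Module ℂ V] where
  /-- The state-field map, by modes. -/
  Y : V →ₗ[ℂ] (ℤ → Module.End ℂ V)
  /-- The vacuum vector. -/
  vac : V
  /-- `u_n v = 0` for `n` sufficiently large. -/
  truncation : ∀ u v : V, ∃ N : ℤ, ∀ n : ℤ, N ≤ n → Y u n v = 0
  /-- `Y(1, z) = Id`. -/
  vac_mode : ∀ n : ℤ, Y vac n = if n = -1 then LinearMap.id else 0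
  /-- `Y(v, z) 1` has no negative powers of `z`. -/
  creation_regular : ∀ (v : V) (n : ℤ), 0 ≤ n → Y v n vac = 0
  /-- The constant term of `Y(v, z) 1` is `v`. -/
  creation : ∀ v : V, Y v (-1) vac = v
  /-- The Jacobi identity
  `z₀⁻¹ δ((z₁ - z₂) / z₀) Y(u, z₁) Y(v, z₂) w - z₀⁻¹ δ((z₂ - z₁) / (-z₀)) Y(v, z₂) Y(u, z₁) w`
  `= z₂⁻¹ δ((z₁ - z₀) / z₂) Y(Y(u, z₀) v, z₂) w`:
  equality of the coefficients of `z₀^(-l-1) z₁^(-m-1) z₂^(-n-1)` for all integers `l`, `m`, `n`.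
  By `truncation` only finitely many terms of each of the three sums are non-zero. -/
  jacobi : ∀ (u v w : V) (l m n : ℤ),
    (∑ᶠ i : ℕ, ((-1 : ℂ) ^ i * (Ring.choose l i : ℤ)) • Y u (m + l - i) (Y v (n + i) w))
      - (∑ᶠ i : ℕ, ((-1 : ℂ) ^ l * (-1 : ℂ) ^ i * (Ring.choose l i : ℤ)) •
          Y v (n + l - i) (Y u (m + i) w))
    = ∑ᶠ i : ℕ, ((Ring.choose m i : ℤ) : ℂ) • Y (Y u (l + i) v) (m + n - i) w

namespace VertexAlgebra

variable (V : Type*) [AddCommGroup V] [Module ℂ V] [VertexAlgebra V]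

variable {V} in
/-- A (two-sided) ideal: a subspace `I` with `v_n a ∈ I` and `a_n v ∈ I` for all `a ∈ I`, `v ∈ V`
and `n ∈ ℤ`. -/
def IsIdeal (I : Submodule ℂ V) : Prop :=
  ∀ (v : V) (n : ℤ), ∀ a ∈ I, Y v n a ∈ I ∧ Y a n v ∈ I

/-- A vertex algebra is simple if it is non-zero and its only ideals are `0` and itself. -/
def IsSimple : Prop :=
  Nontrivial V ∧ ∀ I : Submodule ℂ V, IsIdeal I → I = ⊥ ∨ I = ⊤

/-- The automorphism group of `V`: the invertible linear maps `g` with `g 1 = 1` and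
`g Y(u, z) g⁻¹ = Y(g u, z)`, that is `g (u_n v) = (g u)_n (g v)`, for all `u ∈ V`. -/
def Aut : Subgroup (V ≃ₗ[ℂ] V) where
  carrier := {g | g vac = vac ∧ ∀ (u v : V) (n : ℤ), g (Y u n v) = Y (g u) n (g v)}
  one_mem' := ⟨rfl, fun _ _ _ => rfl⟩
  mul_mem' := by
    rintro a b ⟨ha, ha'⟩ ⟨hb, hb'⟩
    refine ⟨?_, fun u v n => ?_⟩
    · simp [LinearEquiv.mul_apply, ha, hb]
    · simp [LinearEquiv.mul_apply, ha', hb']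
  inv_mem' := by
    rintro a ⟨ha, ha'⟩
    refine ⟨?_, fun u v n => ?_⟩
    · change a.symm vac = vac
      rw [LinearEquiv.symm_apply_eq, ha]
    · change a.symm _ = Y (a.symm u) n (a.symm v)
      rw [LinearEquiv.symm_apply_eq, ha']
      simp

variable {V} in
/-- The natural action of a group of automorphisms of `V` on the vector space `V`. -/
def autRep (G : Subgroup (Aut V)) : Representation ℂ G V where
  toFun g := ((g : Aut V) : V ≃ₗ[ℂ] V).toLinearMap
  map_one' := rfl
  map_mul' _ _ := rfl

end VertexAlgebra

namespace VertexAlgebra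

/-! The heart is that `∑ Y(uᵢ, z) vᵢ = 0` forces `∑ uᵢ ⊗ vᵢ = 0` (`sum_dual_smul_eq_zero`). For
fixed `uᵢ`, such relations survive applying any left or right mode to all `vᵢ`, so the algebra
preserving them acts irreducibly on `V`. Countable dimension gives Schur's lemma, and Jacobson
density then lets rank-one operators onto the vacuum act on the `vᵢ`. A relation `∑ c_g g = 0`
applied to `u_n v` thus yields `∑ c_g gu ⊗ gv = 0`, and Dedekind's argument makes automorphisms
independent. So `ℂ[G]` acts faithfully on `V`; an irreducible module embeds in `ℂ[G]`, hence in `V`.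
-/

theorem finsum_eq_sum_range {M : Type*} [AddCommMonoid M] {f : ℕ → M} {N : ℕ}
    (h : ∀ j, N ≤ j → f j = 0) : ∑ᶠ j, f j = ∑ j ∈ Finset.range N, f j := by
  refine finsum_eq_sum_of_support_subset _ fun j hj => ?_
  by_contra hj'
  exact hj (h j (by simpa using hj'))

/-- If no nonzero polynomial in `φ` annihilates `v`, then vectors `(φ - c)⁻¹ v` for different
scalars `c` are linearly independent. -/
theorem linearIndependent_resolvent {V : Type*} [AddCommGroup V] [Module ℂ V]
    (φ : Module.End ℂ V) (v : V) (hφ : ∀ p : Polynomial ℂ, Polynomial.aeval φ p v = 0 → p = 0)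
    (x : ℂ → V) (hx : ∀ c, φ (x c) - c • x c = v) : LinearIndependent ℂ x := by
  classical
  rw [linearIndependent_iff']
  intro s a ha c₀ hc₀
  have key : ∀ c ∈ s, Polynomial.aeval φ (∏ d ∈ s, (Polynomial.X - Polynomial.C d)) (x c)
      = Polynomial.aeval φ (∏ d ∈ s.erase c, (Polynomial.X - Polynomial.C d)) v := by
    intro c hc
    rw [← Finset.prod_erase_mul s _ hc, map_mul, Module.End.mul_apply]
    congr 1
    rw [← hx c]
    simp [Module.algebraMap_end_apply]
  have h0 : Polynomial.aeval φ
      (∑ c ∈ s, a c • ∏ d ∈ s.erase c, (Polynomial.X - Polynomial.C d)) v = 0 := by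
    have := congrArg (Polynomial.aeval φ (∏ d ∈ s, (Polynomial.X - Polynomial.C d))) ha
    rw [map_sum, map_zero] at this
    rw [map_sum, LinearMap.sum_apply, ← this]
    refine Finset.sum_congr rfl fun c hc => ?_
    rw [map_smul, map_smul, LinearMap.smul_apply, key c hc]
  have h1 := congrArg (Polynomial.eval c₀) (hφ _ h0)
  rw [Polynomial.eval_finsetSum, Finset.sum_eq_single_of_mem c₀ hc₀] at h1
  · rw [Polynomial.eval_smul, Polynomial.eval_prod, Polynomial.eval_zero, smul_eq_mul,
      mul_eq_zero] at h1
    refine h1.resolve_right (Finset.prod_ne_zero_iff.2 fun d hd => ?_)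
    simpa [sub_eq_zero] using (Finset.ne_of_mem_erase hd).symm
  · intro c hc hne
    rw [Polynomial.eval_smul, Polynomial.eval_prod,
      Finset.prod_eq_zero (Finset.mem_erase.2 ⟨hne.symm, hc₀⟩) (by simp), smul_zero]

/-- **Schur's lemma** in countable dimension (Dixmier). -/
theorem exists_eq_smul_of_isSimpleModule {V : Type*} [AddCommGroup V] [Module ℂ V]
    (hdim : Module.rank ℂ V ≤ Cardinal.aleph0) (A : Subalgebra ℂ (Module.End ℂ V))
    [IsSimpleModule A V] (φ : Module.End A V) : ∃ c : ℂ, ∀ v, φ v = c • v := by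
  by_contra! hne
  have hinj : ∀ ψ : Module.End A V, ψ ≠ 0 → Function.Bijective ψ := fun ψ hψ =>
    ψ.bijective_or_eq_zero.resolve_right hψ
  have := IsSimpleModule.nontrivial A V
  obtain ⟨v, hv⟩ := exists_ne (0 : V)
  have hc : ∀ c : ℂ, Function.Bijective (φ - algebraMap ℂ (Module.End A V) c) := by
    intro c
    apply hinj
    intro h
    obtain ⟨w, hw⟩ := hne c
    exact hw (by simpa [sub_eq_zero, Module.algebraMap_end_apply] using congrArg (· w) h)
  have hsp : spectrum ℂ φ = ∅ := by
    ext c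
    simp only [spectrum.mem_iff, Set.mem_empty_iff_false, iff_false, not_not]
    rw [← neg_sub, IsUnit.neg_iff, Module.End.isUnit_iff]
    exact hc c
  have hpol : ∀ p : Polynomial ℂ, Polynomial.aeval φ p = 0 → p = 0 := by
    intro p hp
    by_contra hp0
    rcases lt_or_ge 0 p.degree with hd | hd
    -- Spectral mapping would make the spectrum of `p(φ) = 0` empty, yet it contains `0`.
    · have := spectrum.map_polynomial_aeval_of_degree_pos φ p hd
      rw [hsp, hp, Set.image_empty] at this
      have h0 : (0 : ℂ) ∈ spectrum ℂ (0 : Module.End A V) := by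
        simp
      simp [this] at h0
    · rw [Polynomial.eq_C_of_degree_le_zero hd] at hp hp0
      apply hp0
      rw [Polynomial.aeval_C] at hp
      have := congrArg (· v) hp
      simp [Module.algebraMap_end_apply, hv] at this
      simp [this]
  choose x hx using fun c => (hc c).2 v
  let φ' : Module.End ℂ V := φ.restrictScalars ℂ
  have haev : ∀ (p : Polynomial ℂ) (w : V), Polynomial.aeval φ' p w = Polynomial.aeval φ p w := by
    intro p
    induction p using Polynomial.induction_on' with
    | add p q hp hq => intro w; simp [hp, hq]
    | monomial n a =>
      intro w
      simp only [Polynomial.aeval_monomial, Module.End.mul_apply, Module.algebraMap_end_apply]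
      congr 1
      induction n generalizing w with
      | zero => rfl
      | succ n ih => rw [pow_succ, pow_succ, Module.End.mul_apply, Module.End.mul_apply, ih]; rfl
  have hli := linearIndependent_resolvent φ' v (fun p hp => ?_) x
    (fun c => by
      have := hx c
      simp only [LinearMap.sub_apply, Module.algebraMap_end_apply] at this
      exact this)
  -- The resolvent vectors form an independent family indexed by the uncountable set `ℂ`.
  · have h1 := hli.cardinal_lift_le_rank
    have h2 : Cardinal.aleph0 < Cardinal.mk ℂ := by
      rw [Cardinal.mk_complex]; exact Cardinal.aleph0_lt_continuum
    have h3 := h1.trans (Cardinal.lift_le.2 hdim)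
    rw [Cardinal.lift_aleph0, Cardinal.lift_le_aleph0] at h3
    exact absurd h2 (not_lt.2 h3)
  · refine hpol p (by_contra fun h => hv ((hinj _ h).1 ?_))
    rw [map_zero, ← haev, hp]

/-! ### Nondegeneracy of the vertex operator map -/

variable {V : Type*} [AddCommGroup V] [Module ℂ V] [VertexAlgebra V]

theorem exists_truncation {ι : Type*} (s : Finset ι) (u v : ι → V) :
    ∃ N : ℤ, ∀ i ∈ s, ∀ n, N ≤ n → Y (u i) n (v i) = 0 := by
  classical
  choose N hN using fun i => truncation (u i) (v i)
  obtain ⟨M, hM⟩ := (s.image N).bddAbove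
  exact ⟨M, fun i hi n hn => hN i n (le_trans (hM (by simpa using ⟨i, hi, rfl⟩)) hn)⟩

variable {ι : Type*} {s : Finset ι} {u v : ι → V}

/-- Weak commutativity: relations `∑ Y(uᵢ, z) vᵢ = 0` are preserved by left modes. -/
theorem sum_Y_left_mode (h : ∀ n, ∑ i ∈ s, Y (u i) n (v i) = 0) (a : V) (m n : ℤ) :
    ∑ i ∈ s, Y (u i) n (Y a m (v i)) = 0 := by
  obtain ⟨L₀, hL₀⟩ := exists_truncation s (fun _ => a) u
  obtain ⟨M, hM⟩ := exists_truncation s (fun _ => a) v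
  obtain ⟨Q, hQ⟩ := exists_truncation s u v
  obtain ⟨L, hL⟩ : ∃ L : ℤ, L = max L₀ 0 := ⟨_, rfl⟩
  -- Descending induction on `m`, starting where `a_m vᵢ = 0`.
  suffices H : ∀ (k : ℕ) (m n : ℤ), M ≤ m + k → ∑ i ∈ s, Y (u i) n (Y a m (v i)) = 0 from
    H (M - m).toNat m n (by omega)
  intro k
  induction k using Nat.strong_induction_on with | _ k ih => ?_
  intro m n hk
  rcases Nat.eq_zero_or_pos k with rfl | hk0
  · exact Finset.sum_eq_zero fun i hi => by rw [hM i hi m (by omega), map_zero]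
  obtain ⟨N, hN, hN'⟩ : ∃ N : ℕ, (M - m).toNat < N ∧ (Q - (n - L)).toNat < N :=
    ⟨(M - m).toNat + (Q - (n - L)).toNat + 1, by omega, by omega⟩
  have J : ∀ i ∈ s,
      (∑ j ∈ Finset.range N, ((-1 : ℂ) ^ j * (Ring.choose L j : ℤ)) •
          Y a (m + L - j) (Y (u i) (n - L + j) (v i)))
        - (∑ j ∈ Finset.range N, ((-1 : ℂ) ^ L * (-1 : ℂ) ^ j * (Ring.choose L j : ℤ)) •
          Y (u i) (n - L + L - j) (Y a (m + j) (v i))) = 0 := by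
    intro i hi
    -- As `L ≥ L₀`, the iterate side vanishes. Summed over `i`, the first sum dies by `h`; in the
    -- second, `j = 0` is the goal and `j > 0` raises `m`.
    have := jacobi a (u i) (v i) L m (n - L)
    rw [finsum_eq_sum_range (N := N), finsum_eq_sum_range (N := N), finsum_eq_sum_range (N := 0)]
      at this
    · simpa using this
    · intro j _
      rw [hL₀ i hi (L + j) (by omega), map_zero, Pi.zero_apply, LinearMap.zero_apply, smul_zero]
    · intro j hj
      rw [hM i hi (m + j) (by omega), map_zero, smul_zero]
    · intro j hj
      rw [hQ i hi (n - L + j) (by omega), map_zero, smul_zero]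
  have J' := Finset.sum_eq_zero J
  rw [Finset.sum_sub_distrib, Finset.sum_comm, sub_eq_zero] at J'
  rw [Finset.sum_eq_zero, Finset.sum_comm, Finset.sum_eq_single_of_mem 0] at J'
  · rw [← Finset.smul_sum] at J'
    simpa [zpow_ne_zero] using J'.symm
  · simp; omega
  · intro j _ hj
    rw [← Finset.smul_sum, ih (k - j) (by omega) (m + j) _ (by omega), smul_zero]
  · intro j _
    rw [← Finset.smul_sum, ← map_sum, h, map_zero, smul_zero]

/-- Associativity: relations `∑ Y(uᵢ, z) vᵢ = 0` are preserved by right modes. -/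
theorem sum_Y_right_mode (h : ∀ n, ∑ i ∈ s, Y (u i) n (v i) = 0) (w : V) (m n : ℤ) :
    ∑ i ∈ s, Y (u i) n (Y (v i) m w) = 0 := by
  obtain ⟨P₀, hP₀⟩ := exists_truncation s u (fun _ => w)
  obtain ⟨Q, hQ⟩ := exists_truncation s v (fun _ => w)
  obtain ⟨R, hR⟩ := exists_truncation s u v
  suffices H : ∀ (k : ℕ) (m n : ℤ), Q ≤ m + k → ∑ i ∈ s, Y (u i) n (Y (v i) m w) = 0 from
    H (Q - m).toNat m n (by omega)
  intro k
  induction k using Nat.strong_induction_on with | _ k ih => ?_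
  intro m n hk
  rcases Nat.eq_zero_or_pos k with rfl | hk0
  · exact Finset.sum_eq_zero fun i hi => by rw [hQ i hi m (by omega), map_zero]
  obtain ⟨N, hN, hN'⟩ : ∃ N : ℕ, (Q - m).toNat < N ∧ (R - (n - P₀)).toNat < N :=
    ⟨(Q - m).toNat + (R - (n - P₀)).toNat + 1, by omega, by omega⟩
  have J : ∀ i ∈ s,
      (∑ j ∈ Finset.range N, ((-1 : ℂ) ^ j * (Ring.choose (n - P₀) j : ℤ)) •
          Y (u i) (P₀ + (n - P₀) - j) (Y (v i) (m + j) w))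
        = ∑ j ∈ Finset.range N, ((Ring.choose P₀ j : ℤ) : ℂ) •
          Y (Y (u i) (n - P₀ + j) (v i)) (P₀ + m - j) w := by
    intro i hi
    -- Taking `P₀` as the mode of `uᵢ` on `w` kills the second sum; the iterate side will vanish by
    -- `h`.
    have := jacobi (u i) (v i) w (n - P₀) P₀ m
    rw [finsum_eq_sum_range (N := N), finsum_eq_sum_range (N := 0), finsum_eq_sum_range (N := N)]
      at this
    · simpa using this
    · intro j hj
      rw [hR i hi (n - P₀ + j) (by omega), map_zero, Pi.zero_apply, LinearMap.zero_apply, smul_zero]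
    · intro j _
      rw [hP₀ i hi (P₀ + j) (by omega), map_zero, smul_zero]
    · intro j hj
      rw [hQ i hi (m + j) (by omega), map_zero, smul_zero]
  have J' := Finset.sum_congr rfl J
  rw [Finset.sum_comm, Finset.sum_eq_single_of_mem 0] at J'
  · rw [Finset.sum_comm, Finset.sum_eq_zero (s := Finset.range N)] at J'
    · simpa using J'
    · intro j _
      have : ∑ i ∈ s, Y (Y (u i) (n - P₀ + j) (v i)) (P₀ + m - j) w = 0 := by
        rw [← LinearMap.sum_apply, ← Finset.sum_apply, ← map_sum, h]; simp
      rw [← Finset.smul_sum, this, smul_zero]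
  · simp; omega
  · intro j _ hj
    rw [← Finset.smul_sum, ih (k - j) (by omega) (m + j) _ (by omega), smul_zero]

/-- The operators that preserve all relations `∑ Y(uᵢ, z) vᵢ = 0` for a fixed family `uᵢ`. -/
def relationStabilizer (s : Finset ι) (u : ι → V) : Subalgebra ℂ (Module.End ℂ V) where
  carrier := {T | ∀ v : ι → V, (∀ n, ∑ i ∈ s, Y (u i) n (v i) = 0) →
    ∀ n, ∑ i ∈ s, Y (u i) n (T (v i)) = 0}
  mul_mem' hS hT v hv := hS _ (hT v hv)
  add_mem' hS hT v hv n := by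
    simp [Finset.sum_add_distrib, hS v hv n, hT v hv n]
  algebraMap_mem' c v hv n := by
    simp [Module.algebraMap_end_apply, ← Finset.smul_sum, hv n]

/-- The stabilizer contains all left and right modes, so its submodules are ideals. -/
theorem isSimpleModule_relationStabilizer (hV : IsSimple V) (s : Finset ι) (u : ι → V) :
    IsSimpleModule (relationStabilizer s u) V := by
  have := hV.1
  refine isSimpleModule_iff _ _ |>.2 ⟨fun I => ?_⟩
  have hI : IsIdeal (I.restrictScalars ℂ) := fun v n a ha => by
    let R : Module.End ℂ V :=
      { toFun := fun x => Y x n v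
        map_add' := by simp
        map_smul' := by simp }
    exact ⟨I.smul_mem ⟨Y v n, fun v' hv' => sum_Y_left_mode hv' v n⟩ ha,
      I.smul_mem ⟨R, fun v' hv' => sum_Y_right_mode hv' v n⟩ ha⟩
  simpa using hV.2 _ hI

/-- Nondegeneracy of the vertex operator map: if `∑ Y(uᵢ, z) vᵢ = 0` then `∑ uᵢ ⊗ vᵢ = 0`. -/
theorem sum_dual_smul_eq_zero (hV : IsSimple V) (hdim : Module.rank ℂ V ≤ Cardinal.aleph0)
    (h : ∀ n, ∑ i ∈ s, Y (u i) n (v i) = 0) (f : Module.Dual ℂ V) :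
    ∑ i ∈ s, f (v i) • u i = 0 := by
  classical
  have := isSimpleModule_relationStabilizer hV s u
  -- By Schur the commutant is `ℂ`, so density applies to any `ℂ`-linear map.
  let F : Module.End (Module.End (relationStabilizer s u) V) V :=
    { toFun := fun x => f x • vac
      map_add' := fun x y => by rw [map_add, add_smul]
      map_smul' := fun φ x => by
        obtain ⟨c, hc⟩ := exists_eq_smul_of_isSimpleModule hdim _ φ
        simp [hc, mul_smul] }
  obtain ⟨T, hT⟩ := jacobson_density F (s.image v)
  have h0 := T.2 v h (-1)
  rw [← h0]
  refine Finset.sum_congr rfl fun i hi => ?_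
  have : f (v i) • vac = (T : Module.End ℂ V) (v i) :=
    hT (v i) (Finset.mem_image_of_mem v hi)
  rw [← this, map_smul, creation]

/-- Automorphisms of a simple vertex algebra of countable dimension are linearly independent. -/
theorem linearIndependent_aut (hV : IsSimple V) (hdim : Module.rank ℂ V ≤ Cardinal.aleph0) :
    LinearIndependent ℂ (fun g : Aut V => (g : V ≃ₗ[ℂ] V).toLinearMap) := by
  classical
  rw [linearIndependent_iff']
  intro s
  induction s using Finset.induction_on with
  | empty => simp
  | insert a s ha ih =>
    intro c hc
    have hc' : ∀ v : V, ∑ g ∈ insert a s, c g • (g : V ≃ₗ[ℂ] V) v = 0 := fun v => by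
      simpa using congrArg (· v) hc
    have hrel : ∀ (v : V) (f : Module.Dual ℂ V),
        ∑ g ∈ insert a s, (f ((g : V ≃ₗ[ℂ] V) v) * c g) • (g : V ≃ₗ[ℂ] V).toLinearMap = 0 := by
      intro v f
      ext u
      simp only [LinearMap.sum_apply, LinearMap.smul_apply, mul_smul]
      refine sum_dual_smul_eq_zero hV hdim (u := fun g => c g • (g : V ≃ₗ[ℂ] V) u)
        (v := fun g => (g : V ≃ₗ[ℂ] V) v) (fun n => ?_) f
      rw [← hc' (Y u n v)]
      refine Finset.sum_congr rfl fun g _ => ?_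
      rw [g.2.2 u v n]
      simp
    have hs : ∀ g ∈ s, c g = 0 := by
      intro g hg
      by_contra hcg
      have hga : g ≠ a := fun h => ha (h ▸ hg)
      apply hga
      ext v
      rw [← sub_eq_zero, ← Module.forall_dual_apply_eq_zero_iff ℂ]
      intro f
      -- Subtracting `f (a v)` times the original relation eliminates `a`.
      have := ih (fun g => f ((g : V ≃ₗ[ℂ] V) v) * c g - f ((a : V ≃ₗ[ℂ] V) v) * c g) ?_ g hg
      · rw [← sub_mul, mul_eq_zero, or_iff_left hcg] at this
        rw [map_sub, this]
      · have h1 := hrel v f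
        have h2 := congrArg (f ((a : V ≃ₗ[ℂ] V) v) • ·) hc
        simp only [Finset.smul_sum, smul_zero, smul_smul] at h2
        rw [Finset.sum_insert ha] at h1 h2
        simp only [sub_smul, Finset.sum_sub_distrib]
        rw [← add_sub_add_left_eq_sub, h1, h2, sub_zero]
    intro g hg
    rcases Finset.mem_insert.1 hg with rfl | hg
    · rw [Finset.sum_insert ha, Finset.sum_eq_zero (fun g' hg' => by rw [hs g' hg', zero_smul]),
        add_zero, smul_eq_zero] at hc
      refine hc.resolve_right fun h0 => ?_
      have := hV.1
      obtain ⟨v, hv⟩ := exists_ne (0 : V)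
      exact hv ((g : V ≃ₗ[ℂ] V).map_eq_zero_iff.1 (congrArg (· v) h0))
    · exact hs g hg

end VertexAlgebra

/-! ### Embedding irreducible representations -/

open scoped MonoidAlgebra in
/-- If a representation of a finite group is faithful on the group algebra, then every irreducible
representation embeds in it. -/
theorem Representation.exists_injective_intertwiningMap {k G V W : Type*} [Field k] [CharZero k]
    [Group G] [Finite G] [AddCommGroup V] [Module k V] [AddCommGroup W] [Module k W]
    (σ : Representation k G V) (hσ : LinearIndependent k (fun g => σ g))
    (ρ : Representation k G W) (hρ : ρ.IsIrreducible) :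
    ∃ f : Representation.IntertwiningMap ρ σ, Function.Injective f := by
  have : Fintype G := Fintype.ofFinite G
  have : NeZero (Nat.card G : k) := ⟨by simp⟩
  have hss : IsSemisimpleRing k[G] := inferInstance
  have hW : IsSimpleModule k[G] ρ.asModule :=
    (irreducible_iff_isSimpleModule_asModule ρ).1 hρ
  have := IsSimpleModule.nontrivial k[G] ρ.asModule
  obtain ⟨w, hw⟩ := exists_ne (0 : ρ.asModule)
  let π : k[G] →ₗ[k[G]] ρ.asModule := LinearMap.toSpanSingleton _ _ w
  have hπ : Function.Surjective π := IsSimpleModule.toSpanSingleton_surjective _ hw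
  have : Module.Projective k[G] ρ.asModule := Module.projective_of_isSemisimpleRing _ _
  obtain ⟨j, hj⟩ := Module.projective_lifting_property π LinearMap.id hπ
  have hjw : j w ≠ 0 := fun h => hw (by simpa [h] using (congrArg (· w) hj).symm)
  obtain ⟨v, hv⟩ : ∃ v : σ.asModule, j w • v ≠ 0 := by
    by_contra! h0
    apply hjw
    have h1 : ∑ g, (j w).coeff g • σ g = 0 := by
      ext v
      have h2 := h0 (σ.asModuleEquiv.symm v)
      rw [← map_eq_zero_iff σ.asModuleEquiv σ.asModuleEquiv.injective, asModuleEquiv_map_smul,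
        asAlgebraHom_def, MonoidAlgebra.lift_apply, Finsupp.sum_fintype _ _ (by simp)] at h2
      exact h2
    ext g
    exact linearIndependent_iff'.1 hσ _ _ h1 g (Finset.mem_univ g)
  -- Embed in `k[G]`, then act on `v`: nonzero at `w`, hence injective by irreducibility.
  let f : ρ.asModule →ₗ[k[G]] σ.asModule := (LinearMap.toSpanSingleton _ _ v).comp j
  refine ⟨(IntertwiningMap.equivLinearMapAsModule ρ σ).symm f, ?_⟩
  refine (IsIrreducible.injective_or_eq_zero _).resolve_right fun h => ?_
  rw [LinearEquiv.map_eq_zero_iff] at h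
  exact hv (congrArg (· w) h)

theorem corollary5
    {V : Type*} [AddCommGroup V] [Module ℂ V] [VertexAlgebra V]
    (hsimple : VertexAlgebra.IsSimple V)
    (hdim : Module.rank ℂ V ≤ Cardinal.aleph0)
    (G : Subgroup (VertexAlgebra.Aut V)) [Finite G]
    {W : Type*} [AddCommGroup W] [Module ℂ W]
    (ρ : Representation ℂ G W) (hρ : ρ.IsIrreducible) :
    ∃ U : Subrepresentation (VertexAlgebra.autRep G),
      Nonempty (Representation.Equiv ρ U.toRepresentation) := by
  obtain ⟨f, hf⟩ := Representation.exists_injective_intertwiningMap (VertexAlgebra.autRep G)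
    ((VertexAlgebra.linearIndependent_aut hsimple hdim).comp _ Subtype.val_injective) ρ hρ
  have hcomm : ∀ g w, VertexAlgebra.autRep G g (f w) = f (ρ g w) := fun g w =>
    (congrArg (· w) (f.isIntertwining' g)).symm
  refine ⟨⟨LinearMap.range f.toLinearMap, ?_⟩,
    ⟨.mk (LinearEquiv.ofInjective f.toLinearMap hf) fun g => ?_⟩⟩
  · rintro g _ ⟨w, rfl⟩
    exact ⟨ρ g w, (hcomm g w).symm⟩
  · ext w
    exact (hcomm g w).symm
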